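/- Let $d\ge 1$ be an integer and let $M$ be a $d\times d$ real matrix that is expansive, i.e. every (complex) eigenvalue of $M$ has modulus greater than one. For $f:\mathbb R^d\to\mathbb C$, an invertible real matrix $U$ and $k\in\mathbb Z^d$ write $f_{U;k}(x):=|\det U|^{1/2}f(Ux-k)$; write $\langle f,g\rangle=\int_{\mathbb R^d} f\,\overline{g}$ for the inner product of $L_2(\mathbb R^d)$ and $\hat f(\xi)=\int_{\mathbb R^d}f(x)e^{-ix\cdot\xi}\,dx$ for the Fourier transform. Then there exist two real-valued Schwartz functions $\phi,\psi$ on $\mathbb R^d$ such that: (i) for every integer $J$, the nonhomogeneous system $WS_J(\{\phi\};\{\psi\})=\{\phi_{M^J;k}: k\in\mathbb Z^d\}\cup\{\psi_{M^j;k}: j\ge J,\ k\in\mathbb Z^d\}$ (counted with multiplicity) is a tight frame of $L_2(\mathbb R^d)$: $$\|f\|^2=\sum_{k\in\mathbb Z^d}|\langle f,\phi_{M^J;k}\rangle|^2+\sum_{j=J}^\infty\sum_{k\in\mathbb Z^d}|\langle f,\psi_{M^j;k}\rangle|^2\qquad\text{for all } f\in L_2(\mathbb R^d);$$ (ii) $\hat\phi$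 and $\hat\psi$ are compactly supported even $C^\infty$ functions; (iii) $\hat\psi$ vanishes in a neighborhood of the origin; in particular all moments of $\psi$ vanish: $\int_{\mathbb R^d}x^\alpha\psi(x)\,dx=0$ for all $\alpha\in\mathbb N_0^d$; (iv) there exist $2\pi\mathbb Z^d$-periodic $C^\infty$ functions $a_k,b_k:\mathbb R^d\to\mathbb C$, $k\in\mathbb Z^d$, such that for all $\xi\in\mathbb R^d$ and $k\in\mathbb Z^d$ $$e^{-ik\cdot M^T\xi}\,\hat\phi(M^T\xi)=a_k(\xi)\hat\phi(\xi)\quad\text{and}\quad e^{-ik\cdot M^T\xi}\,\hat\psi(M^T\xi)=b_k(\xi)\hat\phi(\xi).$$ Moreover, the homogeneous system $WS(\{\psi\})=\{\psi_{M^j;k}: j\in\mathbb Z,\ k\in\mathbb Z^d\}$ (counted with multiplicity) is a tight frame of $L_2(\mathbb R^d)$: $$\|f\|^2=\sum_{j\in\mathbb Z}\sum_{k\in\mathbb Z^d}|\langle f,\psi_{M^j;k}\rangle|^2\qquad\text{for all } f\in L_2(\mathbb R^d).$$ -/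

import Mathlib

open MeasureTheory Topology
open scoped ContDiff

noncomputable section

namespace WaveletFrame

/-- The Euclidean space `ℝ^d`. -/
abbrev Space (d : ℕ) : Type := EuclideanSpace ℝ (Fin d)

/-- A real square matrix is expansive if all its (complex) eigenvalues have modulus greater
than one. -/
def IsExpansive {d : ℕ} (M : Matrix (Fin d) (Fin d) ℝ) : Prop :=
  ∀ μ : ℂ, Module.End.HasEigenvalue (Matrix.toLin' (M.map (algebraMap ℝ ℂ))) μ → 1 < ‖μ‖

/-- The vector `U x`, for a real matrix `U` and `x ∈ ℝ^d`. -/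
def matVec {d : ℕ} (U : Matrix (Fin d) (Fin d) ℝ) (x : Space d) : Space d :=
  WithLp.toLp 2 (Matrix.mulVec U x.ofLp)

/-- A lattice point `k ∈ ℤ^d`, as a vector of `ℝ^d`. -/
def latticePt {d : ℕ} (k : Fin d → ℤ) : Space d :=
  WithLp.toLp 2 (fun i => (k i : ℝ))

/-- The dilated and translated function `f_{U;k}(x) = |det U|^{1/2} f (U x - k)`. -/
def dilate {d : ℕ} (U : Matrix (Fin d) (Fin d) ℝ) (k : Space d) (f : Space d → ℂ) :
    Space d → ℂ :=
  fun x => (Real.sqrt |U.det| : ℂ) * f (matVec U x - k)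

/-- The nonhomogeneous `M`-wavelet system `WS_J({φ};{ψ})`, as a family (so that its elements
are counted with multiplicity): `φ_{M^J;k}`, `k ∈ ℤ^d`, together with `ψ_{M^j;k}`, `j ≥ J`,
`k ∈ ℤ^d`. -/
def nonhomSystem {d : ℕ} (M : Matrix (Fin d) (Fin d) ℝ) (J : ℤ) (φ ψ : Space d → ℂ) :
    (Fin d → ℤ) ⊕ ({j : ℤ // J ≤ j} × (Fin d → ℤ)) → Space d → ℂ
  | Sum.inl k => dilate (M ^ J) (latticePt k) φ
  | Sum.inr (j, k) => dilate (M ^ (j : ℤ)) (latticePt k) ψ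

/-- The homogeneous `M`-wavelet system `WS({ψ})`, as a family: `ψ_{M^j;k}`, `j ∈ ℤ`,
`k ∈ ℤ^d`. -/
def homSystem {d : ℕ} (M : Matrix (Fin d) (Fin d) ℝ) (ψ : Space d → ℂ) :
    ℤ × (Fin d → ℤ) → Space d → ℂ :=
  fun p => dilate (M ^ p.1) (latticePt p.2) ψ

/-- A family `e` of functions is a tight (Parseval) frame of `L²(ℝ^d)`: its members are square
integrable and `∑ᵢ |⟨f, eᵢ⟩|² = ‖f‖²` for every `f ∈ L²(ℝ^d)`. -/
def IsTightFrame {d : ℕ} {ι : Type*} (e : ι → Space d → ℂ) : Prop :=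
  ∃ h : ∀ i, MemLp (e i) 2 (volume : Measure (Space d)),
    ∀ f : Lp ℂ 2 (volume : Measure (Space d)),
      HasSum (fun i => ‖inner ℂ ((h i).toLp (e i)) f‖ ^ 2) (‖f‖ ^ 2)

/-- The Fourier transform `f̂(ξ) = ∫ f(x) e^{-i x·ξ} dx`. -/
def fourierHat {d : ℕ} (f : Space d → ℂ) (ξ : Space d) : ℂ :=
  ∫ x : Space d, f x * Complex.exp (-(Complex.I * (inner ℝ x ξ : ℂ)))

/-- A function on `ℝ^d` is `2πℤ^d`-periodic. -/
def IsTwoPiPeriodic {d : ℕ} (a : Space d → ℂ) : Prop :=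
  ∀ (n : Fin d → ℤ) (ξ : Space d), a (ξ + (2 * Real.pi) • latticePt n) = a ξ

/-- A real-valued function on `ℝ^d`, regarded as a complex-valued one. -/
def toComplex {d : ℕ} (f : Space d → ℝ) : Space d → ℂ := fun x => (f x : ℂ)

end WaveletFrame

end

/-!
The generators are built on the frequency side. Let `L = (Mᵀ)⁻¹`. Since `M` is expansive, Gelfand's
formula gives `Lⁿ → 0`, so `L` contracts a quadratic form `Q` (`exists_contracted_form`). Composing
`Q` with a smooth cutoff gives an even smooth angle `θ`, and `Φ = sin θ`, `C = cos θ` satisfy: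
`Φ` is supported in a small ball, `Φ = 1` near the origin, and `Φ (L x) = 1` wherever `Φ x ≠ 0`
(`exists_lowPass_symbol`). The symbols of the two generators are `Φ` and `Ψ x = Φ (L x) * C x`.
Taking sine and cosine makes the square root in `Ψ² = Φ(L ·)² - Φ²` smooth.

* Frames. The supports are so small that their translates by the frequency lattice are disjoint. By
  Plancherel, the coefficients of `f` against the translates at one scale are the Fourier
  coefficients of a function living in one period cell, and Parseval's identity on the torus turns
  the sum of their squares into `∫ Ψ(L^j w)² |f̂(w)|² dw` (`hasSum_sq_inner_dilate`). With
  `E j = ∫ Φ(L^j w)² |f̂(w)|² dw` this is `E (j + 1) - E j`, so the sum over the scales telescopes;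
  `E j → ‖f‖²` as `j → ∞` and `E j → 0` as `j → -∞` by dominated convergence.
* Refinability. `Φ(Mᵀ x) = Φ(Mᵀ x) Φ(x)` and `Ψ(Mᵀ x) = C(Mᵀ x) Φ(x)`; the first factor only matters
  on the support of `Φ`, where it agrees with a smooth periodic function
  (`exists_periodic_extension`).
* Moments. `Ψ` vanishes near the origin, and multiplication by a coordinate is differentiation of
  the Fourier transform.

Symbols are normalized as in Mathlib's `𝓕`, with kernel `e^{-2πi x·w}`, so that the frequency
lattice is `ℤᵈ`; `fourierHat_eq_fourier` translates to angular frequency.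
-/

namespace WaveletFrame

open Filter
open scoped FourierTransform SchwartzMap LineDeriv ComplexConjugate

/-! ### Powers of the inverse of an expansive matrix -/

theorem IsExpansive.det_ne_zero {d : ℕ} {M : Matrix (Fin d) (Fin d) ℝ} (hM : IsExpansive M) :
    M.det ≠ 0 := by
  intro h0
  have h1 : (M.map (algebraMap ℝ ℂ)).det = 0 := by
    rw [← RingHom.mapMatrix_apply, ← RingHom.map_det, h0, map_zero]
  obtain ⟨v, hv, hv0⟩ := Matrix.exists_mulVec_eq_zero_iff.mpr h1
  have := hM 0 (Module.End.hasEigenvalue_of_hasEigenvector (x := v)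
    (by rw [Module.End.hasEigenvector_iff, Module.End.mem_eigenspace_iff]
        exact ⟨by simpa using hv0, hv⟩))
  norm_num at this

theorem tendsto_pow_of_spectralRadius_lt_one {A : Type*} [NormedRing A] [NormedAlgebra ℂ A]
    [CompleteSpace A] {a : A} (ha : spectralRadius ℂ a < 1) :
    Tendsto (fun n : ℕ => a ^ n) atTop (𝓝 0) := by
  obtain ⟨ρ, hρ, hρ1⟩ := ENNReal.lt_iff_exists_nnreal_btwn.mp ha
  have hρ1 : ρ < 1 := by exact_mod_cast hρ1
  have h := (spectrum.pow_nnnorm_pow_one_div_tendsto_nhds_spectralRadius a).eventually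
    (gt_mem_nhds hρ)
  refine squeeze_zero_norm' (a := fun n : ℕ => (ρ : ℝ) ^ n) ?_
    (tendsto_pow_atTop_nhds_zero_of_lt_one ρ.2 (by exact_mod_cast hρ1))
  filter_upwards [h, eventually_gt_atTop 0] with n hn hn0
  have h2 := ENNReal.rpow_le_rpow hn.le (Nat.cast_nonneg (α := ℝ) n)
  rw [← ENNReal.rpow_mul, one_div, inv_mul_cancel₀ (by positivity), ENNReal.rpow_one,
    ENNReal.rpow_natCast] at h2
  exact_mod_cast h2

section
attribute [local instance] Matrix.linftyOpNormedRing Matrix.linftyOpNormedAlgebra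

/-- The eigenvalues of the complexified inverse lie inside the unit disc, so its spectral radius is
less than one. -/
theorem IsExpansive.tendsto_inv_pow {d : ℕ} (hd : 0 < d) {M : Matrix (Fin d) (Fin d) ℝ}
    (hM : IsExpansive M) (i j : Fin d) : Tendsto (fun n : ℕ => (M⁻¹ ^ n) i j) atTop (𝓝 0) := by
  have : Nonempty (Fin d) := ⟨⟨0, hd⟩⟩
  obtain ⟨u, rfl⟩ := (Matrix.isUnit_iff_isUnit_det M).mpr (isUnit_iff_ne_zero.mpr hM.det_ne_zero)
  set f : Matrix (Fin d) (Fin d) ℝ →+* Matrix (Fin d) (Fin d) ℂ := (algebraMap ℝ ℂ).mapMatrix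
  set v : (Matrix (Fin d) (Fin d) ℂ)ˣ := Units.map (f : _ →* _) u
  have hr : spectralRadius ℂ ((v⁻¹ : (Matrix (Fin d) (Fin d) ℂ)ˣ) : Matrix (Fin d) (Fin d) ℂ)
      < 1 := by
    refine spectrum.spectralRadius_lt_of_forall_lt _ (r := 1) fun k hk => ?_
    rw [← spectrum.map_inv, Set.mem_inv, ← Matrix.spectrum_toLin',
      ← Module.End.hasEigenvalue_iff_mem_spectrum] at hk
    have h1 := hM _ hk
    rw [norm_inv] at h1
    by_contra! h2
    exact h1.not_ge (inv_le_one_of_one_le₀ h2)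
  have h1 := tendsto_pow_of_spectralRadius_lt_one hr
  have h2 : Tendsto (fun n : ℕ => (((v⁻¹ : (Matrix (Fin d) (Fin d) ℂ)ˣ) :
      Matrix (Fin d) (Fin d) ℂ) ^ n) i j) atTop (𝓝 0) :=
    ((continuous_apply_apply i j).tendsto (0 : Fin d → Fin d → ℂ)).comp h1
  refine ((Complex.continuous_re.tendsto _).comp h2).congr fun n => ?_
  have h3 : (((v⁻¹ : (Matrix (Fin d) (Fin d) ℂ)ˣ) : Matrix (Fin d) (Fin d) ℂ) ^ n) =
      f ((u : Matrix (Fin d) (Fin d) ℝ)⁻¹ ^ n) := by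
    rw [map_pow, ← Matrix.coe_units_inv]; rfl
  simp only [Function.comp_apply, h3, f]
  rfl
end

/-- `(Mᵀ)⁻¹`, which contracts the frequency domain, as a continuous linear map. -/
noncomputable def dualInv {d : ℕ} (M : Matrix (Fin d) (Fin d) ℝ) : Space d →L[ℝ] Space d :=
  Matrix.toEuclideanCLM (𝕜 := ℝ) (M⁻¹).transpose

theorem IsExpansive.tendsto_dualInv_pow {d : ℕ} (hd : 0 < d) {M : Matrix (Fin d) (Fin d) ℝ}
    (hM : IsExpansive M) : Tendsto (fun n : ℕ => dualInv M ^ n) atTop (𝓝 0) := by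
  have h1 : Tendsto (fun n : ℕ => (M⁻¹ ^ n).transpose) atTop (𝓝 0) :=
    tendsto_pi_nhds.mpr fun i => tendsto_pi_nhds.mpr fun j => hM.tendsto_inv_pow hd j i
  have h2 : Continuous (Matrix.toEuclideanCLM (n := Fin d) (𝕜 := ℝ)) :=
    LinearMap.continuous_of_finiteDimensional
      (Matrix.toEuclideanCLM (n := Fin d) (𝕜 := ℝ)).toAlgEquiv.toLinearMap
  have h3 := (h2.tendsto 0).comp h1
  rw [map_zero] at h3
  refine h3.congr fun n => ?_
  simp only [Function.comp_apply, dualInv, ← map_pow, Matrix.transpose_pow]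

/-! ### The low-pass symbol -/

/-- A power of `L` is a contraction; summing `‖Lⁿ x‖²` below that power gives a quadratic form
that `L` itself contracts. -/
theorem exists_contracted_form {E : Type*} [NormedAddCommGroup E] [InnerProductSpace ℝ E]
    {L : E →L[ℝ] E} (hL : Tendsto (fun n : ℕ => L ^ n) atTop (𝓝 0)) :
    ∃ (Q : E → ℝ) (ρ : ℝ), 0 < ρ ∧ ρ < 1 ∧ ContDiff ℝ ∞ Q ∧ (∀ x, Q (-x) = Q x) ∧
      (∀ x, ‖x‖ ^ 2 ≤ Q x) ∧ (∀ x, Q (L x) ≤ ρ * Q x) ∧ Q 0 = 0 := by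
  obtain ⟨m, hm, hm0⟩ : ∃ m : ℕ, ‖L ^ m‖ ≤ 1 / 2 ∧ 0 < m := by
    have h1 := (tendsto_norm.comp hL)
    rw [norm_zero] at h1
    exact ((h1.eventually (ge_mem_nhds (by norm_num : (0 : ℝ) < 1 / 2))).and
      (eventually_gt_atTop 0)).exists
  set Q : E → ℝ := fun x => ∑ n ∈ Finset.range m, ‖(L ^ n) x‖ ^ 2 with hQ
  set C : ℝ := 1 + ∑ n ∈ Finset.range m, ‖L ^ n‖ ^ 2 with hC
  have hC1 : 1 ≤ C := le_add_of_nonneg_right (Finset.sum_nonneg fun n _ => by positivity)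
  have hQC : ∀ x, Q x ≤ C * ‖x‖ ^ 2 := fun x => by
    have : Q x ≤ ∑ n ∈ Finset.range m, ‖L ^ n‖ ^ 2 * ‖x‖ ^ 2 :=
      Finset.sum_le_sum fun n _ => by
        rw [← mul_pow]
        gcongr
        exact (L ^ n).le_opNorm x
    rw [← Finset.sum_mul] at this
    nlinarith [sq_nonneg ‖x‖]
  have hQL : ∀ x, Q (L x) = Q x - ‖x‖ ^ 2 + ‖(L ^ m) x‖ ^ 2 := fun x => by
    have h1 : Q (L x) = ∑ n ∈ Finset.range m, ‖(L ^ (n + 1)) x‖ ^ 2 := by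
      simp only [hQ, pow_succ, mul_apply_eq_comp]
    have h2 := Finset.sum_range_succ (fun n => ‖(L ^ n) x‖ ^ 2) m
    rw [Finset.sum_range_succ'] at h2
    simp only [pow_zero, one_apply_eq_self] at h2
    rw [h1]
    simp only [hQ]
    linarith
  refine ⟨Q, 1 - 1 / (2 * C), ?_, ?_, ?_, ?_, ?_, ?_, ?_⟩
  · rw [sub_pos, div_lt_one (by positivity)]
    linarith
  · have : 0 < 1 / (2 * C) := by positivity
    linarith
  · exact ContDiff.sum fun n _ => (L ^ n).contDiff.norm_sq ℝ
  · intro x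
    simp [hQ]
  · intro x
    have := Finset.single_le_sum (f := fun n => ‖(L ^ n) x‖ ^ 2) (fun n _ => by positivity)
      (Finset.mem_range.mpr hm0)
    simpa only [pow_zero, one_apply_eq_self] using this
  · intro x
    have h1 : ‖(L ^ m) x‖ ^ 2 ≤ 1 / 4 * ‖x‖ ^ 2 := by
      have h2 : ‖(L ^ m) x‖ ≤ 1 / 2 * ‖x‖ := ((L ^ m).le_opNorm x).trans (by gcongr)
      nlinarith [norm_nonneg ((L ^ m) x)]
    have h3 : 1 / (2 * C) * Q x ≤ 1 / 2 * ‖x‖ ^ 2 := by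
      rw [div_mul_eq_mul_div, div_le_iff₀ (by positivity)]
      nlinarith [hQC x]
    rw [hQL]
    nlinarith [sq_nonneg ‖x‖]
  · simp [hQ]

/-- The low-pass symbol `Φ = sin θ` together with its complement `C = cos θ`, where `θ` is a
smooth cutoff of the quadratic form contracted by `L`. -/
theorem exists_lowPass_symbol {E : Type*} [NormedAddCommGroup E] [InnerProductSpace ℝ E]
    {N L : E →L[ℝ] E} (hNL : ∀ x, N (L x) = x)
    (hL : Tendsto (fun n : ℕ => L ^ n) atTop (𝓝 0)) {r : ℝ} (hr : 0 < r) :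
    ∃ Φ C : E → ℝ, ContDiff ℝ ∞ Φ ∧ ContDiff ℝ ∞ C ∧ (∀ x, Φ (-x) = Φ x) ∧ (∀ x, C (-x) = C x) ∧
      (∀ x, Φ x ^ 2 + C x ^ 2 = 1) ∧ (∀ᶠ x in 𝓝 0, Φ x = 1) ∧ (∀ x, Φ x ≠ 0 → ‖x‖ ≤ r) ∧
      (∀ x, Φ (L x) ≠ 0 → ‖x‖ ≤ r) ∧ (∀ x, Φ x ≠ 0 → Φ (L x) = 1) := by
  obtain ⟨Q, ρ, hρ0, hρ1, hQs, hQe, hQn, hQL, hQ0⟩ := exists_contracted_form hL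
  -- `Φ x ≠ 0` will force `‖x‖ ≤ ε`, and `Φ (L x) ≠ 0` will force `‖x‖ ≤ ‖N‖ ε`.
  obtain ⟨ε, hε, hεr⟩ : ∃ ε : ℝ, 0 < ε ∧ (1 + ‖N‖) * ε ≤ r :=
    ⟨r / (1 + ‖N‖), by positivity, by rw [mul_div_cancel₀ _ (by positivity)]⟩
  set h : ℝ → ℝ := fun t => Real.smoothTransition ((ε ^ 2 - t) / (ε ^ 2 * (1 - ρ))) with hh
  have hden : 0 < ε ^ 2 * (1 - ρ) := by
    have : 0 < 1 - ρ := by linarith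
    positivity
  have hone : ∀ t, t ≤ ρ * ε ^ 2 → h t = 1 := fun t ht =>
    Real.smoothTransition.one_of_one_le (by rw [le_div_iff₀ hden]; linarith)
  have hzero : ∀ t, ε ^ 2 ≤ t → h t = 0 := fun t ht =>
    Real.smoothTransition.zero_of_nonpos (div_nonpos_of_nonpos_of_nonneg (by linarith) hden.le)
  set θ : E → ℝ := fun x => Real.pi / 2 * h (Q x) with hθ
  have hθs : ContDiff ℝ ∞ θ := by
    refine contDiff_const.mul ((Real.smoothTransition.contDiff (n := ⊤)).comp ?_)
    exact (contDiff_const.sub hQs).div_const _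
  have hsupp : ∀ x, Real.sin (θ x) ≠ 0 → Q x < ε ^ 2 := fun x hx => by
    by_contra! h1
    exact hx (by simp [hθ, hzero _ h1])
  have hΦ1 : ∀ x, Q x ≤ ρ * ε ^ 2 → Real.sin (θ x) = 1 := fun x hx => by
    simp [hθ, hone _ hx]
  have hnorm : ∀ x, Real.sin (θ x) ≠ 0 → ‖x‖ ≤ ε := fun x hx =>
    le_of_sq_le_sq ((hQn x).trans (hsupp x hx).le) hε.le
  have hNε : 0 ≤ ‖N‖ * ε := by positivity
  refine ⟨fun x => Real.sin (θ x), fun x => Real.cos (θ x), Real.contDiff_sin.comp hθs,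
    Real.contDiff_cos.comp hθs, fun x => by simp [hθ, hQe], fun x => by simp [hθ, hQe],
    fun x => Real.sin_sq_add_cos_sq _, ?_, fun x hx => ?_, fun x hx => ?_, fun x hx => ?_⟩
  · have : ∀ᶠ x in 𝓝 (0 : E), Q x < ρ * ε ^ 2 :=
      (hQs.continuous.tendsto 0).eventually (gt_mem_nhds (by rw [hQ0]; positivity))
    exact this.mono fun x hx => hΦ1 x hx.le
  · linarith [hnorm x hx]
  · have h1 := N.le_opNorm (L x)
    rw [hNL] at h1
    have h2 : ‖N‖ * ‖L x‖ ≤ ‖N‖ * ε := by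
      gcongr
      exact hnorm _ hx
    linarith
  · refine hΦ1 _ ((hQL x).trans ?_)
    have := hsupp x hx
    gcongr

/-! ### Periodic extension of smooth functions -/

/-- A smooth periodic function that is the identity near the origin, obtained by composing a
smooth extension of `arcsin` with `sin`. -/
theorem exists_periodic_eq_id :
    ∃ p : ℝ → ℝ, ContDiff ℝ ∞ p ∧ (∀ (t : ℝ) (n : ℤ), p (t + 2 * Real.pi * n) = p t) ∧
      ∀ t, |t| ≤ 1 / 2 → p t = t := by
  -- `χ = 1` on `[-1/2, 1/2]`, which contains `sin t` for `|t| ≤ 1/2`; its support `[-3/4, 3/4]` avoids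
  -- the endpoints `±1`, where `arcsin` is not smooth.
  let χ : ContDiffBump (0 : ℝ) := ⟨1 / 2, 3 / 4, by norm_num, by norm_num⟩
  set A : ℝ → ℝ := fun s => χ s * Real.arcsin s with hA
  have hAs : ContDiff ℝ ∞ A := by
    refine contDiff_iff_contDiffAt.mpr fun x => ?_
    by_cases hx1 : x ∈ tsupport χ
    swap
    · refine (contDiffAt_const (c := (0 : ℝ))).congr_of_eventuallyEq ?_
      filter_upwards [notMem_tsupport_iff_eventuallyEq.mp hx1] with y hy
      simp [hA, hy]
    rw [χ.tsupport_eq, Metric.mem_closedBall, dist_zero_right, Real.norm_eq_abs, abs_le] at hx1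
    have hx1 : -(3 / 4) ≤ x ∧ x ≤ 3 / 4 := hx1
    exact χ.contDiff.contDiffAt.mul
      (Real.contDiffAt_arcsin (by linarith [hx1.1]) (by linarith [hx1.2]))
  refine ⟨fun t => A (Real.sin t), hAs.comp Real.contDiff_sin, fun t n => ?_, fun t ht => ?_⟩
  · simp only [mul_comm _ (n : ℝ), Real.sin_add_int_mul_two_pi]
  · have h1 : |Real.sin t| ≤ 1 / 2 := Real.abs_sin_le_abs.trans ht
    have h2 : χ (Real.sin t) = 1 :=
      χ.one_of_mem_closedBall (by rw [mem_closedBall_zero_iff]; exact h1)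
    rw [abs_le] at ht
    simp only [hA, h2, one_mul]
    exact Real.arcsin_sin (by linarith [Real.pi_gt_three]) (by linarith [Real.pi_gt_three])

/-- A smooth function agrees near the origin with a smooth `2πℤᵈ`-periodic function. -/
theorem exists_periodic_extension {d : ℕ} {g : Space d → ℂ} (hg : ContDiff ℝ ∞ g) :
    ∃ a : Space d → ℂ, (ContDiff ℝ ∞ a ∧ IsTwoPiPeriodic a) ∧ ∀ ξ, ‖ξ‖ ≤ 1 / 2 → a ξ = g ξ := by
  obtain ⟨p, hp, hper, hid⟩ := exists_periodic_eq_id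
  refine ⟨fun ξ => g (WithLp.toLp 2 fun i => p (ξ i)), ⟨?_, fun n ξ => ?_⟩, fun ξ hξ => ?_⟩
  · refine hg.comp (contDiff_euclidean.mpr fun i => ?_)
    exact hp.comp (contDiff_euclidean.mp contDiff_id i)
  · refine congrArg g (PiLp.ext fun i => ?_)
    exact hper (ξ i) (n i)
  · refine congrArg g (PiLp.ext fun i => ?_)
    exact hid _ ((PiLp.norm_apply_le ξ i).trans hξ)

/-! ### Linear changes of variables and Parseval's identity in a period cell -/

variable {d : ℕ}

theorem matVec_mul (A B : Matrix (Fin d) (Fin d) ℝ) (x : Space d) :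
    matVec (A * B) x = matVec A (matVec B x) := by
  simp [matVec, Matrix.mulVec_mulVec]

theorem matVec_one (x : Space d) : matVec 1 x = x := by
  simp [matVec]

theorem inner_matVec_left (A : Matrix (Fin d) (Fin d) ℝ) (x y : Space d) :
    inner ℝ (matVec A x) y = inner ℝ x (matVec A.transpose y) := by
  simp only [matVec, EuclideanSpace.inner_eq_star_dotProduct, star_trivial, Matrix.mulVec_transpose]
  rw [← Matrix.dotProduct_mulVec, dotProduct_comm]

theorem contDiff_matVec (A : Matrix (Fin d) (Fin d) ℝ) : ContDiff ℝ ∞ (matVec A) :=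
  (Matrix.toEuclideanCLM (𝕜 := ℝ) A).contDiff

theorem map_matVec_volume {A : Matrix (Fin d) (Fin d) ℝ} (hA : A.det ≠ 0) :
    Measure.map (matVec A) (volume : Measure (Space d)) = ENNReal.ofReal |A.det⁻¹| • volume := by
  have hdet : LinearMap.det (Matrix.toLpLin 2 2 A) = A.det := by
    rw [Matrix.toLpLin_eq_toLin, LinearMap.det_toLin]
  have := Measure.map_linearMap_addHaar_eq_smul_addHaar (volume : Measure (Space d))
    (f := Matrix.toLpLin 2 2 A) (by rwa [hdet])
  rwa [hdet] at this

theorem measurableEmbedding_matVec {A : Matrix (Fin d) (Fin d) ℝ} (hA : A.det ≠ 0) :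
    MeasurableEmbedding (matVec A) := by
  refine (LinearMap.isClosedEmbedding_of_injective (𝕜 := ℝ) (f := Matrix.toLpLin 2 2 A)
    (LinearMap.ker_eq_bot.mpr ?_)).measurableEmbedding
  refine Function.LeftInverse.injective (g := matVec A⁻¹) fun x => ?_
  change matVec A⁻¹ (matVec A x) = x
  rw [← matVec_mul, Matrix.nonsing_inv_mul _ (isUnit_iff_ne_zero.mpr hA), matVec_one]

theorem integral_comp_matVec {F : Type*} [NormedAddCommGroup F] [NormedSpace ℝ F]
    {A : Matrix (Fin d) (Fin d) ℝ} (hA : A.det ≠ 0) (f : Space d → F) :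
    ∫ x, f x = |A.det| • ∫ x, f (matVec A x) := by
  rw [← (measurableEmbedding_matVec hA).integral_map, map_matVec_volume hA,
    integral_smul_measure, ENNReal.toReal_ofReal (abs_nonneg _), smul_smul, abs_inv,
    mul_inv_cancel₀ (abs_ne_zero.mpr hA), one_smul]

theorem _root_.MeasureTheory.MemLp.comp_matVec {F : Type*} [NormedAddCommGroup F]
    {A : Matrix (Fin d) (Fin d) ℝ} (hA : A.det ≠ 0) {f : Space d → F} {p : ENNReal}
    (hf : MemLp f p volume) : MemLp (fun x => f (matVec A x)) p volume := by
  have h1 : MemLp f p (Measure.map (matVec A) (volume : Measure (Space d))) := by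
    rw [map_matVec_volume hA]
    exact hf.smul_measure ENNReal.ofReal_ne_top
  exact h1.comp_of_map (measurableEmbedding_matVec hA).measurable.aemeasurable

section Torus

/-- The normalized Haar measure on the circle, as in the theory of Fourier series on the torus. -/
noncomputable local instance : MeasureSpace UnitAddCircle := ⟨AddCircle.haarAddCircle⟩

/-- Parseval's identity on `ℝᵈ` for a function supported in a single period cell. -/
theorem hasSum_sq_integral_exp_of_support {q : Space d → ℂ} (hq : MemLp q 2 volume)
    (hs : ∀ x, q x ≠ 0 → ‖x‖ < 1 / 2) :
    HasSum (fun k : Fin d → ℤ =>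
      ‖∫ x, Complex.exp (2 * Real.pi * Complex.I * (inner ℝ (latticePt k) x : ℝ)) * q x‖ ^ 2)
      (∫ x, ‖q x‖ ^ 2) := by
  set b : Fin d → ℝ := fun _ => -(1 / 2) with hb
  set S : Set (Fin d → ℝ) := {x | ∀ i, x i ∈ Set.Ioc (b i) (b i + 1)} with hS
  have hSm : MeasurableSet S := MeasurableSet.univ_pi' fun i => measurableSet_Ioc
  -- `G` is `q` on the period cell `S`, transported to the torus.
  set G : UnitAddTorus (Fin d) → ℂ := fun t =>
    q (WithLp.toLp 2 (UnitAddTorus.measurableEquivPiIoc b t).1) with hG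
  have hqpi : MemLp (fun x : Fin d → ℝ => q (WithLp.toLp 2 x)) 2 volume :=
    hq.comp_measurePreserving (PiLp.volume_preserving_toLp (Fin d))
  have hGm : MemLp G 2 volume :=
    (hqpi.restrict S).comp_measurePreserving
      ((measurePreserving_subtype_coe hSm).comp (UnitAddTorus.measurePreserving_equivPiIoc b))
  have hGS : ∀ x ∈ S, G (fun i => (x i : UnitAddCircle)) = q (WithLp.toLp 2 x) := fun x hx => by
    simp only [hG]
    congr 2
    funext i
    simp [AddCircle.equivIoc_coe_eq (hx i)]
  have hqS : ∀ x, x ∉ S → q (WithLp.toLp 2 x) = 0 := fun x hx => by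
    by_contra h1
    refine hx fun i => ?_
    have h2 := (PiLp.norm_apply_le (WithLp.toLp 2 x : Space d) i).trans_lt (hs _ h1)
    rw [Real.norm_eq_abs, abs_lt] at h2
    have h2 : -(1 / 2) < x i ∧ x i < 1 / 2 := h2
    constructor
    · exact h2.1
    · simp only [hb]; linarith [h2.2]
  have hint : ∀ {V : Type} [NormedAddCommGroup V] [NormedSpace ℝ V] (F : (Fin d → ℝ) → ℂ → V),
      (∀ x, F x 0 = 0) → ∫ x in S, F x (G (fun i => (x i : UnitAddCircle))) =
        ∫ x : Space d, F x.ofLp (q x) := fun F hF => by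
    rw [setIntegral_congr_fun hSm (fun x hx => by rw [hGS x hx]),
      setIntegral_eq_integral_of_forall_compl_eq_zero (fun x hx => by rw [hqS x hx, hF])]
    exact (PiLp.volume_preserving_toLp (Fin d)).integral_comp
      (MeasurableEquiv.toLp 2 (Fin d → ℝ)).measurableEmbedding (fun x => F x.ofLp (q x))
  have hpars := UnitAddTorus.hasSum_sq_mFourierCoeff (MemLp.toLp G hGm)
  have hnorm : ∫ t, ‖MemLp.toLp G hGm t‖ ^ 2 = ∫ x, ‖q x‖ ^ 2 := by
    rw [integral_congr_ae (hGm.coeFn_toLp.mono fun t ht => by rw [ht]),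
      UnitAddTorus.integral_preimage _ b]
    exact hint (fun _ z => ‖z‖ ^ 2) (fun _ => by simp)
  rw [hnorm] at hpars
  -- `mFourierCoeff` carries the opposite sign in the exponent.
  rw [← (Equiv.neg (Fin d → ℤ)).hasSum_iff]
  refine hpars.congr_fun fun k => ?_
  have hcoef : UnitAddTorus.mFourierCoeff (MemLp.toLp G hGm) k = UnitAddTorus.mFourierCoeff G k :=
    integral_congr_ae (hGm.coeFn_toLp.mono fun t ht => by simp only [ht])
  rw [hcoef, UnitAddTorus.mFourierCoeff_eq_integral _ _ b]
  rw [hint (fun x z => UnitAddTorus.mFourier (-k) (fun i => (x i : UnitAddCircle)) • z)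
    (fun _ => smul_zero _)]
  refine congrArg (fun z : ℂ => ‖z‖ ^ 2) (integral_congr_ae (.of_forall fun x => ?_))
  simp only [smul_eq_mul]
  congr 1
  simp only [UnitAddTorus.mFourier, ContinuousMap.coe_mk, fourier_coe_apply, ← Complex.exp_sum]
  congr 1
  simp [latticePt, PiLp.inner_apply, Finset.mul_sum]
  refine Finset.sum_congr rfl fun i _ => by ring

end Torus

/-! ### Generators with prescribed symbols and their frame coefficients -/

theorem hasCompactSupport_of_norm_le {V : Type*} [Zero V] {f : Space d → V} {r : ℝ}
    (h : ∀ x, f x ≠ 0 → ‖x‖ ≤ r) : HasCompactSupport f :=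
  HasCompactSupport.intro (isCompact_closedBall (0 : Space d) r) fun x hx => by
    by_contra h0
    exact hx (by simpa using h x h0)

/-- A compactly supported smooth even real symbol is the Fourier transform of a real-valued
Schwartz function. -/
theorem exists_schwartz_of_symbol {Ψ : Space d → ℝ} (hs : ContDiff ℝ ∞ Ψ)
    (he : ∀ x, Ψ (-x) = Ψ x) (hc : HasCompactSupport Ψ) :
    ∃ ψ : 𝓢(Space d, ℝ), ∀ x, (ψ x : ℂ) = 𝓕⁻ (fun w => (Ψ w : ℂ)) x := by
  have hsC : ContDiff ℝ ∞ (fun w => (Ψ w : ℂ)) := Complex.ofRealCLM.contDiff.comp hs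
  have hcC : HasCompactSupport (fun w => (Ψ w : ℂ)) := hc.comp_left Complex.ofReal_zero
  set S : 𝓢(Space d, ℂ) := hcC.toSchwartzMap hsC
  refine ⟨SchwartzMap.postcompCLM Complex.reCLM (𝓕⁻ S), fun x => ?_⟩
  have h1 : (𝓕⁻ S) x = 𝓕⁻ (fun w => (Ψ w : ℂ)) x := by rw [SchwartzMap.fourierInv_coe]; rfl
  rw [SchwartzMap.postcompCLM_apply, h1]
  -- The inverse transform is already real, because the symbol is real and even.
  refine Complex.conj_eq_iff_re.mp ?_
  rw [Real.fourierInv_eq', ← integral_conj, ← integral_neg_eq_self]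
  refine integral_congr_ae (.of_forall fun v => ?_)
  simp [he, ← Complex.exp_conj, map_ofNat]

theorem fourier_toComplex_eq {Ψ : Space d → ℝ} (hs : ContDiff ℝ ∞ Ψ) (hc : HasCompactSupport Ψ)
    {ψ : Space d → ℝ} (hψ : ∀ x, (ψ x : ℂ) = 𝓕⁻ (fun w => (Ψ w : ℂ)) x) (w : Space d) :
    𝓕 (toComplex ψ) w = Ψ w := by
  have hsC : ContDiff ℝ ∞ (fun w => (Ψ w : ℂ)) := Complex.ofRealCLM.contDiff.comp hs
  have hcC : HasCompactSupport (fun w => (Ψ w : ℂ)) := hc.comp_left Complex.ofReal_zero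
  set S : 𝓢(Space d, ℂ) := hcC.toSchwartzMap hsC
  have h1 : toComplex ψ = 𝓕⁻ S := by
    funext x
    rw [SchwartzMap.fourierInv_coe]
    exact hψ x
  rw [h1, ← SchwartzMap.fourier_coe, FourierTransform.fourier_fourierInv_eq]
  rfl

/-- The Fourier transform in angular frequency is a rescaling of the one in ordinary frequency. -/
theorem fourierHat_eq_fourier (f : Space d → ℂ) (ξ : Space d) :
    fourierHat f ξ = 𝓕 f ((2 * Real.pi)⁻¹ • ξ) := by
  rw [Real.fourier_eq', fourierHat]
  refine integral_congr_ae (.of_forall fun v => ?_)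
  simp only [smul_eq_mul, inner_smul_right]
  rw [mul_comm]
  congr 2
  push_cast
  field_simp

/-- The symbol of `ψ_{U;k}`: the Fourier transform of a dilated and translated function, in terms
of the Fourier transform `Ψ` of the function. -/
noncomputable def dilateSymbol (U : Matrix (Fin d) (Fin d) ℝ) (k : Space d) (Ψ : Space d → ℝ)
    (w : Space d) : ℂ :=
  (Real.sqrt |U.det| : ℂ)⁻¹ *
    Complex.exp (-(2 * Real.pi * Complex.I * (inner ℝ k (matVec (U⁻¹).transpose w) : ℝ))) *
    Ψ (matVec (U⁻¹).transpose w)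

theorem contDiff_dilateSymbol (U : Matrix (Fin d) (Fin d) ℝ) (k : Space d) {Ψ : Space d → ℝ}
    (hs : ContDiff ℝ ∞ Ψ) : ContDiff ℝ ∞ (dilateSymbol U k Ψ) := by
  have h1 := contDiff_matVec (U⁻¹).transpose
  have h2 : ContDiff ℝ ∞ fun w : Space d => (inner ℝ k (matVec (U⁻¹).transpose w) : ℝ) :=
    contDiff_const.inner ℝ h1
  have h3 : ContDiff ℝ ∞ fun w : Space d => ((inner ℝ k (matVec (U⁻¹).transpose w) : ℝ) : ℂ) :=
    Complex.ofRealCLM.contDiff.comp h2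
  have h4 : ContDiff ℝ ∞ fun w : Space d => ((Ψ (matVec (U⁻¹).transpose w) : ℝ) : ℂ) :=
    Complex.ofRealCLM.contDiff.comp (hs.comp h1)
  exact (contDiff_const.mul (contDiff_const.mul h3).neg.cexp).mul h4

theorem matVec_transpose_inv_cancel {U : Matrix (Fin d) (Fin d) ℝ} (hU : U.det ≠ 0)
    (x : Space d) : matVec (U⁻¹).transpose (matVec U.transpose x) = x := by
  rw [← matVec_mul, ← Matrix.transpose_mul, Matrix.mul_nonsing_inv _ (isUnit_iff_ne_zero.mpr hU),
    Matrix.transpose_one, matVec_one]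

theorem dilateSymbol_matVec {U : Matrix (Fin d) (Fin d) ℝ} (hU : U.det ≠ 0) (k : Space d)
    (Ψ : Space d → ℝ) (v : Space d) : dilateSymbol U k Ψ (matVec U.transpose v) =
      (Real.sqrt |U.det| : ℂ)⁻¹ * Complex.exp (-(2 * Real.pi * Complex.I * (inner ℝ k v : ℝ))) *
      Ψ v := by
  rw [dilateSymbol, matVec_transpose_inv_cancel hU]

theorem hasCompactSupport_dilateSymbol {U : Matrix (Fin d) (Fin d) ℝ} (hU : U.det ≠ 0)
    (k : Space d) {Ψ : Space d → ℝ} (hc : HasCompactSupport Ψ) :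
    HasCompactSupport (dilateSymbol U k Ψ) := by
  refine HasCompactSupport.intro (hc.isCompact.image (contDiff_matVec U.transpose).continuous)
    fun w hw => ?_
  have : Ψ (matVec (U⁻¹).transpose w) = 0 := by
    by_contra h0
    refine hw ⟨_, subset_tsupport _ h0, ?_⟩
    rw [← matVec_mul, ← Matrix.transpose_mul,
      Matrix.nonsing_inv_mul _ (isUnit_iff_ne_zero.mpr hU), Matrix.transpose_one, matVec_one]
  simp [dilateSymbol, this]

theorem abs_det_mul_inv_sqrt {U : Matrix (Fin d) (Fin d) ℝ} (hU : U.det ≠ 0) :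
    ((|U.det| : ℝ) : ℂ) * (Real.sqrt |U.det| : ℂ)⁻¹ = (Real.sqrt |U.det| : ℂ) := by
  have h0 : Real.sqrt |U.det| ≠ 0 := (Real.sqrt_pos.mpr (abs_pos.mpr hU)).ne'
  rw [← Complex.ofReal_inv, ← Complex.ofReal_mul, ← div_eq_mul_inv, Real.div_sqrt]

/-- Substituting `w = Uᵀ v` in the inverse Fourier integral turns the symbol into a dilation. -/
theorem fourierInv_dilateSymbol {U : Matrix (Fin d) (Fin d) ℝ} (hU : U.det ≠ 0)
    (k : Space d) {Ψ : Space d → ℝ} {ψ : Space d → ℝ}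
    (hψ : ∀ x, (ψ x : ℂ) = 𝓕⁻ (fun w => (Ψ w : ℂ)) x) :
    𝓕⁻ (dilateSymbol U k Ψ) = dilate U k (toComplex ψ) := by
  funext x
  have hUt : U.transpose.det ≠ 0 := by rwa [Matrix.det_transpose]
  rw [dilate, toComplex, hψ, Real.fourierInv_eq', Real.fourierInv_eq',
    integral_comp_matVec (F := ℂ) hUt, Matrix.det_transpose, Complex.real_smul,
    ← abs_det_mul_inv_sqrt hU, mul_assoc, ← integral_const_mul ((Real.sqrt |U.det| : ℂ)⁻¹)]
  congr 1
  refine integral_congr_ae (.of_forall fun v => ?_)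
  simp only [dilateSymbol_matVec hU, smul_eq_mul, inner_sub_right, inner_matVec_left,
    Matrix.transpose_transpose]
  rw [real_inner_comm v k]
  have : Complex.exp (((2 * Real.pi * (inner ℝ v (matVec U x) - inner ℝ v k) : ℝ) : ℂ) *
      Complex.I) = Complex.exp (((2 * Real.pi * inner ℝ v (matVec U x) : ℝ) : ℂ) * Complex.I) *
      Complex.exp (-(2 * Real.pi * Complex.I * (inner ℝ v k : ℝ))) := by
    rw [← Complex.exp_add]
    congr 1
    push_cast
    ring
  rw [this]
  ring

/-- The dilated and translated generator, as the inverse Fourier transform of a Schwartz symbol. -/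
theorem exists_schwartz_dilate {Ψ : Space d → ℝ} (hs : ContDiff ℝ ∞ Ψ)
    (hc : HasCompactSupport Ψ) {ψ : Space d → ℝ}
    (hψ : ∀ x, (ψ x : ℂ) = 𝓕⁻ (fun w => (Ψ w : ℂ)) x)
    {U : Matrix (Fin d) (Fin d) ℝ} (hU : U.det ≠ 0) (k : Space d) :
    ∃ H : 𝓢(Space d, ℂ), (∀ w, H w = dilateSymbol U k Ψ w) ∧
      ((𝓕⁻ H : 𝓢(Space d, ℂ)) : Space d → ℂ) = dilate U k (toComplex ψ) := by
  refine ⟨(hasCompactSupport_dilateSymbol hU k hc).toSchwartzMap (contDiff_dilateSymbol U k hs),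
    fun w => rfl, ?_⟩
  rw [SchwartzMap.fourierInv_coe]
  exact fourierInv_dilateSymbol hU k hψ

theorem memLp_dilate {Ψ : Space d → ℝ} (hs : ContDiff ℝ ∞ Ψ)
    (hc : HasCompactSupport Ψ) {ψ : Space d → ℝ}
    (hψ : ∀ x, (ψ x : ℂ) = 𝓕⁻ (fun w => (Ψ w : ℂ)) x)
    {U : Matrix (Fin d) (Fin d) ℝ} (hU : U.det ≠ 0) (k : Space d) :
    MemLp (dilate U k (toComplex ψ)) 2 volume := by
  obtain ⟨H, -, hH⟩ := exists_schwartz_dilate hs hc hψ hU k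
  rw [← hH]
  exact (𝓕⁻ H).memLp 2 volume

/-- The frame coefficient against `ψ_{U;k}` is a Fourier coefficient of the function
`v ↦ |det U|^{1/2} Ψ(v) f̂(Uᵀ v)`. -/
theorem inner_dilate_eq_integral {Ψ : Space d → ℝ} (hs : ContDiff ℝ ∞ Ψ)
    (hc : HasCompactSupport Ψ) {ψ : Space d → ℝ}
    (hψ : ∀ x, (ψ x : ℂ) = 𝓕⁻ (fun w => (Ψ w : ℂ)) x)
    {U : Matrix (Fin d) (Fin d) ℝ} (hU : U.det ≠ 0) (k : Space d)
    (hm : MemLp (dilate U k (toComplex ψ)) 2 volume) (f : Lp ℂ 2 (volume : Measure (Space d))) :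
    inner ℂ (hm.toLp _) f =
      ∫ v, Complex.exp (2 * Real.pi * Complex.I * (inner ℝ k v : ℝ)) *
        ((Real.sqrt |U.det| : ℂ) * Ψ v *
          (𝓕 f : Lp ℂ 2 (volume : Measure (Space d))) (matVec U.transpose v)) := by
  obtain ⟨H, hHw, hH⟩ := exists_schwartz_dilate hs hc hψ hU k
  have h1 : hm.toLp _ = 𝓕⁻ (H.toLp 2) := by
    rw [SchwartzMap.toLp_fourierInv_eq]
    simp only [SchwartzMap.toLp, hH]
  rw [h1, ← Lp.inner_fourier_eq, FourierTransform.fourier_fourierInv_eq, L2.inner_def]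
  have h2 : ∫ w, inner ℂ (H.toLp 2 volume w) ((𝓕 f : Lp ℂ 2 (volume : Measure (Space d))) w) =
      ∫ w, conj (dilateSymbol U k Ψ w) * (𝓕 f : Lp ℂ 2 (volume : Measure (Space d))) w :=
    integral_congr_ae ((H.coeFn_toLp 2 volume).mono fun w hw => by
      simp only [hw, hHw, RCLike.inner_apply'])
  have hUt : U.transpose.det ≠ 0 := by rwa [Matrix.det_transpose]
  rw [h2, integral_comp_matVec (F := ℂ) hUt, Matrix.det_transpose, Complex.real_smul,
    ← integral_const_mul]
  refine integral_congr_ae (.of_forall fun v => ?_)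
  simp only [dilateSymbol_matVec hU, map_mul, map_inv₀, Complex.conj_ofReal, ← Complex.exp_conj,
    map_neg, Complex.conj_I, map_ofNat]
  simp only [mul_neg, neg_mul, neg_neg]
  linear_combination (Complex.exp (2 * Real.pi * Complex.I * (inner ℝ k v : ℝ)) * Ψ v *
    (𝓕 f : Lp ℂ 2 (volume : Measure (Space d))) (matVec U.transpose v)) * abs_det_mul_inv_sqrt hU

/-- The energy of `f` at one scale: since the translates of the support of `Ψ` by `ℤᵈ` do not
overlap, Parseval's identity on the torus computes it as a weighted energy of `f̂`. -/
theorem hasSum_sq_inner_dilate {Ψ : Space d → ℝ} (hs : ContDiff ℝ ∞ Ψ)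
    (hsupp : ∀ x, Ψ x ≠ 0 → ‖x‖ < 1 / 2) {ψ : Space d → ℝ}
    (hψ : ∀ x, (ψ x : ℂ) = 𝓕⁻ (fun w => (Ψ w : ℂ)) x)
    {U : Matrix (Fin d) (Fin d) ℝ} (hU : U.det ≠ 0)
    (hm : ∀ k : Fin d → ℤ, MemLp (dilate U (latticePt k) (toComplex ψ)) 2 volume)
    (f : Lp ℂ 2 (volume : Measure (Space d))) :
    HasSum (fun k => ‖inner ℂ ((hm k).toLp _) f‖ ^ 2)
      (∫ w, Ψ (matVec (U⁻¹).transpose w) ^ 2 *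
        ‖(𝓕 f : Lp ℂ 2 (volume : Measure (Space d))) w‖ ^ 2) := by
  have hc : HasCompactSupport Ψ := hasCompactSupport_of_norm_le fun x hx => (hsupp x hx).le
  have hUt : U.transpose.det ≠ 0 := by rwa [Matrix.det_transpose]
  set g : Lp ℂ 2 (volume : Measure (Space d)) := 𝓕 f with hg
  set q : Space d → ℂ := fun v => (Real.sqrt |U.det| : ℂ) * Ψ v * g (matVec U.transpose v) with hq
  have hqm : MemLp q 2 volume := by
    have h1 : Continuous fun v => (Real.sqrt |U.det| : ℂ) * Ψ v :=
      continuous_const.mul (Complex.continuous_ofReal.comp hs.continuous)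
    have h2 : HasCompactSupport fun v => (Real.sqrt |U.det| : ℂ) * Ψ v :=
      (hc.comp_left (g := fun t : ℝ => (Real.sqrt |U.det| : ℂ) * (t : ℂ)) (by simp))
    exact ((Lp.memLp g).comp_matVec hUt).mul (h1.memLp_top_of_hasCompactSupport h2 volume)
  have hqs : ∀ x, q x ≠ 0 → ‖x‖ < 1 / 2 := fun x hx => hsupp x fun h0 => hx (by simp [hq, h0])
  have h := hasSum_sq_integral_exp_of_support hqm hqs
  have hint : ∫ x, ‖q x‖ ^ 2 = ∫ w, Ψ (matVec (U⁻¹).transpose w) ^ 2 * ‖g w‖ ^ 2 := by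
    symm
    rw [integral_comp_matVec hUt, Matrix.det_transpose, smul_eq_mul, ← integral_const_mul]
    refine integral_congr_ae (.of_forall fun v => ?_)
    simp only [hq, matVec_transpose_inv_cancel hU, norm_mul, mul_pow, Complex.norm_real,
      Real.norm_eq_abs, sq_abs, Real.sq_sqrt (abs_nonneg _)]
    ring
  rw [hint] at h
  refine h.congr_fun fun k => ?_
  rw [inner_dilate_eq_integral hs hc hψ hU _ (hm k) f]

/-! ### Telescoping sums -/

theorem hasSum_prod_of_nonneg {β γ : Type*} {f : β × γ → ℝ} {g : β → ℝ} {a : ℝ} (h0 : 0 ≤ f)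
    (hf : ∀ b, HasSum (fun c => f (b, c)) (g b)) (hg : HasSum g a) : HasSum f a := by
  have hs : Summable f := (summable_prod_of_nonneg h0).mpr
    ⟨fun b => (hf b).summable, hg.summable.congr fun b => (hf b).tsum_eq.symm⟩
  have h := hs.hasSum.prod_fiberwise hf
  rw [← h.unique hg]
  exact hs.hasSum

theorem hasSum_sum_type {β γ α : Type*} [AddCommMonoid α] [TopologicalSpace α] [ContinuousAdd α]
    {f : β ⊕ γ → α} {a b : α} (ha : HasSum (fun x => f (Sum.inl x)) a)
    (hb : HasSum (fun x => f (Sum.inr x)) b) : HasSum f (a + b) :=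
  HasSum.add_isCompl Set.isCompl_range_inl_range_inr
    (Sum.inl_injective.hasSum_range_iff.mpr ha) (Sum.inr_injective.hasSum_range_iff.mpr hb)

theorem hasSum_nat_telescope {E : ℕ → ℝ} (h0 : ∀ n, E n ≤ E (n + 1)) {b : ℝ}
    (hb : Tendsto E atTop (𝓝 b)) : HasSum (fun n => E (n + 1) - E n) (b - E 0) := by
  rw [hasSum_iff_tendsto_nat_of_nonneg (fun n => sub_nonneg.mpr (h0 n))]
  simp only [Finset.sum_range_sub]
  exact hb.sub_const _

theorem hasSum_ge_telescope {E : ℤ → ℝ} (h0 : ∀ n, E n ≤ E (n + 1)) {b : ℝ}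
    (hb : Tendsto E atTop (𝓝 b)) (J : ℤ) :
    HasSum (fun j : {j : ℤ // J ≤ j} => E (j + 1) - E j) (b - E J) := by
  let e : ℕ ≃ {j : ℤ // J ≤ j} :=
    { toFun := fun n => ⟨J + n, by omega⟩
      invFun := fun j => (j.1 - J).toNat
      left_inv := fun n => by simp
      right_inv := fun j => Subtype.ext (by have := j.2; simp only; omega) }
  rw [← e.hasSum_iff]
  have h1 := hasSum_nat_telescope (E := fun n : ℕ => E (J + n))
    (fun n => by simpa [add_assoc] using h0 (J + n))
    (hb.comp (tendsto_atTop_add_const_left _ J tendsto_natCast_atTop_atTop))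
  simpa [e, Function.comp_def, add_assoc] using h1

theorem hasSum_int_telescope {E : ℤ → ℝ} (h0 : ∀ n, E n ≤ E (n + 1)) {a b : ℝ}
    (ha : Tendsto E atBot (𝓝 a)) (hb : Tendsto E atTop (𝓝 b)) :
    HasSum (fun j : ℤ => E (j + 1) - E j) (b - a) := by
  have h1 := hasSum_nat_telescope (E := fun n : ℕ => E n) (fun n => by simpa using h0 n)
    (hb.comp tendsto_natCast_atTop_atTop)
  have h2 := hasSum_nat_telescope (E := fun n : ℕ => -E (-n))
    (fun n => by
      have := h0 (-(n + 1))
      rw [neg_add_rev, neg_add_cancel_comm] at this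
      push_cast
      rw [neg_add_rev]
      linarith)
    ((ha.comp (tendsto_neg_atTop_atBot.comp tendsto_natCast_atTop_atTop)).neg)
  have h3 := HasSum.of_nat_of_neg_add_one (f := fun j : ℤ => E (j + 1) - E j)
    (by simpa using h1) (h2.congr_fun fun n => by
      have : -((n : ℤ) + 1) + 1 = -n := by ring
      simp only [this]
      push_cast
      ring)
  convert h3 using 1
  simp
  ring

/-! ### Vanishing moments -/

/-- Multiplying by a coordinate differentiates the Fourier transform, so it preserves vanishing
of the Fourier transform near the origin. -/
theorem fourier_coord_smul_eventually_zero {g : 𝓢(Space d, ℂ)}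
    (hg : ∀ᶠ ξ in 𝓝 (0 : Space d), (𝓕 g) ξ = 0) (i : Fin d) :
    ∃ g' : 𝓢(Space d, ℂ), (∀ x, g' x = x i * g x) ∧
      ∀ᶠ ξ in 𝓝 (0 : Space d), (𝓕 g') ξ = 0 := by
  set m : Space d := EuclideanSpace.single i 1 with hm
  have hgr : (inner ℝ · m : Space d → ℝ).HasTemperateGrowth :=
    ((innerSL ℝ).flip m).hasTemperateGrowth
  refine ⟨SchwartzMap.smulLeftCLM ℂ (inner ℝ · m) g, fun x => ?_, ?_⟩
  · rw [SchwartzMap.smulLeftCLM_apply_apply hgr]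
    have h0 : (inner ℝ x m : ℝ) = x i := by
      rw [real_inner_comm, hm, EuclideanSpace.inner_single_left]
      simp
    simp [h0]
  · have h1 := SchwartzMap.lineDerivOp_fourier_eq g m
    have h2 : ∀ᶠ ξ in 𝓝 (0 : Space d), (∂_{m} (𝓕 g)) ξ = 0 := by
      filter_upwards [hg.eventually_nhds] with ξ hξ
      rw [SchwartzMap.lineDerivOp_apply_eq_fderiv]
      have : (fun y => (𝓕 g) y) =ᶠ[𝓝 ξ] fun _ => (0 : ℂ) := hξ
      rw [this.fderiv_eq]
      simp
    filter_upwards [h2] with ξ hξ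
    rw [h1, FourierTransform.fourier_smul] at hξ
    have h3 : -(2 * Real.pi * Complex.I) ≠ 0 := by
      simp [Real.pi_ne_zero]
    simpa [h3, Real.pi_ne_zero] using hξ

theorem fourier_monomial_smul_eventually_zero {g : 𝓢(Space d, ℂ)}
    (hg : ∀ᶠ ξ in 𝓝 (0 : Space d), (𝓕 g) ξ = 0) (α : Fin d → ℕ) (s : Finset (Fin d)) :
    ∃ g' : 𝓢(Space d, ℂ), (∀ x, g' x = ((∏ i ∈ s, x i ^ α i : ℝ) : ℂ) * g x) ∧
      ∀ᶠ ξ in 𝓝 (0 : Space d), (𝓕 g') ξ = 0 := by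
  have hpow : ∀ (i : Fin d) (n : ℕ) (g : 𝓢(Space d, ℂ)),
      (∀ᶠ ξ in 𝓝 (0 : Space d), (𝓕 g) ξ = 0) →
      ∃ g' : 𝓢(Space d, ℂ), (∀ x, g' x = ((x i ^ n : ℝ) : ℂ) * g x) ∧
        ∀ᶠ ξ in 𝓝 (0 : Space d), (𝓕 g') ξ = 0 := by
    intro i n g hg
    induction n with
    | zero => exact ⟨g, fun x => by simp, hg⟩
    | succ n ih =>
      obtain ⟨g₁, h₁, hz₁⟩ := ih
      obtain ⟨g₂, h₂, hz₂⟩ := fourier_coord_smul_eventually_zero hz₁ i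
      refine ⟨g₂, fun x => ?_, hz₂⟩
      rw [h₂, h₁]
      push_cast
      ring
  induction s using Finset.induction_on with
  | empty => exact ⟨g, fun x => by simp, hg⟩
  | insert i s hi ih =>
    obtain ⟨g₁, h₁, hz₁⟩ := ih
    obtain ⟨g₂, h₂, hz₂⟩ := hpow i (α i) g₁ hz₁
    refine ⟨g₂, fun x => ?_, hz₂⟩
    rw [h₂, h₁, Finset.prod_insert hi]
    push_cast
    ring

/-- All moments vanish when the Fourier transform vanishes near the origin: the moment of order
`α` is a multiple of the value at the origin of the derivative of order `α`. -/
theorem integral_monomial_mul_eq_zero {ψ : 𝓢(Space d, ℝ)}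
    (hψ : ∀ᶠ ξ in 𝓝 (0 : Space d), 𝓕 (toComplex ψ) ξ = 0) (α : Fin d → ℕ) :
    ∫ x : Space d, (∏ i, x i ^ α i) * ψ x = 0 := by
  set g : 𝓢(Space d, ℂ) := SchwartzMap.postcompCLM Complex.ofRealCLM ψ with hg
  have hgψ : (g : Space d → ℂ) = toComplex ψ := by
    funext x
    simp [hg, toComplex]
  obtain ⟨g', h', hz'⟩ := fourier_monomial_smul_eventually_zero (g := g)
    (by simpa only [SchwartzMap.fourier_coe, hgψ] using hψ) α Finset.univ
  have h0 := hz'.self_of_nhds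
  rw [SchwartzMap.fourier_coe, Real.fourier_eq'] at h0
  simp only [inner_zero_right, mul_zero, Complex.ofReal_zero, zero_mul, Complex.exp_zero,
    one_smul, h', hgψ, toComplex, ← Complex.ofReal_mul] at h0
  rw [integral_complex_ofReal] at h0
  exact_mod_cast h0

/-! ### The low-pass energy at scale `j` -/

/-- The frequency-side action `((M^j)⁻¹)ᵀ w = (Mᵀ)^{-j} w` of the dilation by `M^j`. -/
noncomputable def dualPow (M : Matrix (Fin d) (Fin d) ℝ) (j : ℤ) (w : Space d) : Space d :=
  matVec ((M ^ j)⁻¹).transpose w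

theorem dualPow_add_one {M : Matrix (Fin d) (Fin d) ℝ} (hM : M.det ≠ 0) (j : ℤ) (w : Space d) :
    dualPow M (j + 1) w = dualInv M (dualPow M j w) := by
  change _ = matVec (M⁻¹).transpose (dualPow M j w)
  rw [dualPow, add_comm, Matrix.zpow_one_add (isUnit_iff_ne_zero.mpr hM), Matrix.mul_inv_rev,
    Matrix.transpose_mul, matVec_mul, dualPow]

theorem dualPow_add_natCast {M : Matrix (Fin d) (Fin d) ℝ} (hM : M.det ≠ 0) (j : ℤ) (n : ℕ)
    (w : Space d) : dualPow M (j + n) w = (dualInv M ^ n) (dualPow M j w) := by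
  induction n with
  | zero => simp
  | succ n ih =>
    rw [Nat.cast_succ, ← add_assoc, dualPow_add_one hM, ih, pow_succ', mul_apply_eq_comp]

theorem dualPow_zero (M : Matrix (Fin d) (Fin d) ℝ) (w : Space d) : dualPow M 0 w = w := by
  rw [dualPow, zpow_zero, inv_one, Matrix.transpose_one, matVec_one]

theorem tendsto_dualPow_atTop {M : Matrix (Fin d) (Fin d) ℝ} (hM : M.det ≠ 0)
    (hL : Tendsto (fun n : ℕ => dualInv M ^ n) atTop (𝓝 0)) (w : Space d) :
    Tendsto (fun j => dualPow M j w) atTop (𝓝 0) := by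
  rw [← Nat.map_cast_int_atTop, tendsto_map'_iff]
  have h1 := ((ContinuousLinearMap.apply ℝ (Space d) w).continuous.tendsto 0).comp hL
  rw [map_zero] at h1
  refine h1.congr fun n => ?_
  have h2 := dualPow_add_natCast hM 0 n w
  rw [zero_add, dualPow_zero] at h2
  exact h2.symm

theorem eventually_lt_norm_dualPow_atBot {M : Matrix (Fin d) (Fin d) ℝ} (hM : M.det ≠ 0)
    (hL : Tendsto (fun n : ℕ => dualInv M ^ n) atTop (𝓝 0)) {w : Space d} (hw : w ≠ 0) (r : ℝ) :
    ∀ᶠ j in atBot, r < ‖dualPow M j w‖ := by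
  have h1 : ∀ᶠ n : ℕ in atTop, r < ‖dualPow M (-(n : ℤ)) w‖ := by
    have h2 : Tendsto (fun n : ℕ => ‖dualInv M ^ n‖ * r) atTop (𝓝 0) := by
      simpa using (tendsto_norm.comp hL).mul_const r
    filter_upwards [h2.eventually (gt_mem_nhds (norm_pos_iff.mpr hw))] with n hn
    by_contra! h3
    have h4 := dualPow_add_natCast hM (-(n : ℤ)) n w
    rw [neg_add_cancel, dualPow_zero] at h4
    have h5 := (dualInv M ^ n).le_opNorm (dualPow M (-(n : ℤ)) w)
    rw [← h4] at h5
    exact hn.not_ge (h5.trans (by gcongr))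
  have h6 : ∀ᶠ j : ℤ in atTop, r < ‖dualPow M (-j) w‖ := by
    rw [← Nat.map_cast_int_atTop]
    exact h1
  filter_upwards [tendsto_neg_atBot_atTop.eventually h6] with j hj
  rwa [neg_neg] at hj

theorem integrable_norm_sq (g : Lp ℂ 2 (volume : Measure (Space d))) :
    Integrable (fun w => ‖g w‖ ^ 2) volume := by
  simpa using (Lp.memLp g).integrable_norm_pow two_ne_zero

theorem integral_norm_sq_fourier (f : Lp ℂ 2 (volume : Measure (Space d))) :
    ∫ w, ‖(𝓕 f : Lp ℂ 2 (volume : Measure (Space d))) w‖ ^ 2 = ‖f‖ ^ 2 := by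
  have h1 := inner_self_eq_norm_sq_to_K (𝕜 := ℂ) (𝓕 f : Lp ℂ 2 (volume : Measure (Space d)))
  rw [L2.inner_def, Lp.norm_fourier_eq] at h1
  simp only [inner_self_eq_norm_sq_to_K] at h1
  have h2 : ∫ w, (((‖(𝓕 f : Lp ℂ 2 (volume : Measure (Space d))) w‖ ^ 2 : ℝ)) : ℂ) =
      ((‖f‖ ^ 2 : ℝ) : ℂ) := by
    simpa using h1
  rw [integral_complex_ofReal] at h2
  exact_mod_cast h2

/-- The energy of `g` seen by the low-pass symbol `Φ` at scale `j`. -/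
noncomputable def energy (M : Matrix (Fin d) (Fin d) ℝ) (Φ : Space d → ℝ)
    (g : Lp ℂ 2 (volume : Measure (Space d))) (j : ℤ) : ℝ :=
  ∫ w, Φ (dualPow M j w) ^ 2 * ‖g w‖ ^ 2

theorem continuous_dualPow (M : Matrix (Fin d) (Fin d) ℝ) (j : ℤ) : Continuous (dualPow M j) :=
  (contDiff_matVec _).continuous

theorem integrable_energy (M : Matrix (Fin d) (Fin d) ℝ) {Φ : Space d → ℝ} (hΦ : Continuous Φ)
    (hΦ1 : ∀ x, Φ x ^ 2 ≤ 1) (g : Lp ℂ 2 (volume : Measure (Space d))) (j : ℤ) :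
    Integrable (fun w => Φ (dualPow M j w) ^ 2 * ‖g w‖ ^ 2) volume :=
  (integrable_norm_sq g).bdd_mul (c := 1)
    ((hΦ.comp (continuous_dualPow M j)).pow 2).aestronglyMeasurable
    (.of_forall fun w => by simpa using hΦ1 (dualPow M j w))

theorem tendsto_energy_of_eventually (M : Matrix (Fin d) (Fin d) ℝ) {Φ : Space d → ℝ}
    (hΦ : Continuous Φ) (hΦ1 : ∀ x, Φ x ^ 2 ≤ 1) (g : Lp ℂ 2 (volume : Measure (Space d)))
    {l : Filter ℤ} [l.IsCountablyGenerated] {c : ℝ}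
    (h : ∀ᵐ w, ∀ᶠ j in l, Φ (dualPow M j w) = c) :
    Tendsto (energy M Φ g) l (𝓝 (∫ w, c ^ 2 * ‖g w‖ ^ 2)) := by
  refine tendsto_integral_filter_of_dominated_convergence (fun w => ‖g w‖ ^ 2)
    (.of_forall fun j => (integrable_energy M hΦ hΦ1 g j).aestronglyMeasurable)
    (.of_forall fun j => .of_forall fun w => ?_) (integrable_norm_sq g) ?_
  · rw [Real.norm_of_nonneg (by positivity)]
    exact mul_le_of_le_one_left (by positivity) (hΦ1 _)
  · filter_upwards [h] with w hw
    exact tendsto_const_nhds.congr' (hw.mono fun j hj => by simp only [hj])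

theorem tendsto_energy_atTop {M : Matrix (Fin d) (Fin d) ℝ} (hM : M.det ≠ 0)
    (hL : Tendsto (fun n : ℕ => dualInv M ^ n) atTop (𝓝 0)) {Φ : Space d → ℝ} (hΦ : Continuous Φ)
    (hΦ1 : ∀ x, Φ x ^ 2 ≤ 1) (hΦ0 : ∀ᶠ x in 𝓝 0, Φ x = 1)
    (f : Lp ℂ 2 (volume : Measure (Space d))) :
    Tendsto (energy M Φ (𝓕 f)) atTop (𝓝 (‖f‖ ^ 2)) := by
  have h := tendsto_energy_of_eventually M hΦ hΦ1 (𝓕 f) (l := atTop) (c := 1)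
    (.of_forall fun w => (tendsto_dualPow_atTop hM hL w).eventually hΦ0)
  simpa only [one_pow, one_mul, integral_norm_sq_fourier] using h

theorem tendsto_energy_atBot (hd : 0 < d) {M : Matrix (Fin d) (Fin d) ℝ} (hM : M.det ≠ 0)
    (hL : Tendsto (fun n : ℕ => dualInv M ^ n) atTop (𝓝 0)) {Φ : Space d → ℝ} (hΦ : Continuous Φ)
    (hΦ1 : ∀ x, Φ x ^ 2 ≤ 1) {r : ℝ} (hΦr : ∀ x, Φ x ≠ 0 → ‖x‖ ≤ r)
    (g : Lp ℂ 2 (volume : Measure (Space d))) :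
    Tendsto (energy M Φ g) atBot (𝓝 0) := by
  -- Positive dimension makes the origin, where the low-pass weight never vanishes, a null set.
  have : Nonempty (Fin d) := ⟨⟨0, hd⟩⟩
  have h := tendsto_energy_of_eventually M hΦ hΦ1 g (l := atBot) (c := 0) (by
    filter_upwards [compl_mem_ae_iff.mpr (measure_singleton (0 : Space d))] with w hw
    filter_upwards [eventually_lt_norm_dualPow_atBot hM hL hw r] with j hj
    by_contra h0
    exact hj.not_ge (hΦr _ h0))
  simpa using h

/-! ### Tight frames -/

section Frames

variable {M : Matrix (Fin d) (Fin d) ℝ} {Φ Ψ : Space d → ℝ} {φ ψ : 𝓢(Space d, ℝ)}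

theorem det_zpow_ne_zero (hM : M.det ≠ 0) (j : ℤ) : (M ^ j).det ≠ 0 :=
  ((isUnit_iff_ne_zero.mpr hM).det_zpow j).ne_zero

/-- The energy seen by the high-pass symbol at scale `j` is the increment of the low-pass energy. -/
theorem integral_highPass_eq_sub (hM : M.det ≠ 0) (hΦ : Continuous Φ) (hΦ1 : ∀ x, Φ x ^ 2 ≤ 1)
    (hΨ : ∀ x, Ψ x ^ 2 = Φ (dualInv M x) ^ 2 - Φ x ^ 2)
    (g : Lp ℂ 2 (volume : Measure (Space d))) (j : ℤ) :
    ∫ w, Ψ (matVec ((M ^ j)⁻¹).transpose w) ^ 2 * ‖g w‖ ^ 2 =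
      energy M Φ g (j + 1) - energy M Φ g j := by
  rw [energy, energy, ← integral_sub (integrable_energy M hΦ hΦ1 g _)
    (integrable_energy M hΦ hΦ1 g _)]
  refine integral_congr_ae (.of_forall fun w => ?_)
  simp only [hΨ, dualPow_add_one hM]
  rw [dualPow]
  ring

theorem energy_le_add_one (hM : M.det ≠ 0) (hΦ : Continuous Φ) (hΦ1 : ∀ x, Φ x ^ 2 ≤ 1)
    (hΨ : ∀ x, Ψ x ^ 2 = Φ (dualInv M x) ^ 2 - Φ x ^ 2)
    (g : Lp ℂ 2 (volume : Measure (Space d))) (j : ℤ) : energy M Φ g j ≤ energy M Φ g (j + 1) := by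
  rw [← sub_nonneg, ← integral_highPass_eq_sub hM hΦ hΦ1 hΨ]
  exact integral_nonneg fun w => by positivity

theorem isTightFrame_nonhomSystem (hM : M.det ≠ 0)
    (hL : Tendsto (fun n : ℕ => dualInv M ^ n) atTop (𝓝 0))
    (hΦs : ContDiff ℝ ∞ Φ) (hΨs : ContDiff ℝ ∞ Ψ) (hΦ1 : ∀ x, Φ x ^ 2 ≤ 1)
    (hΦ0 : ∀ᶠ x in 𝓝 0, Φ x = 1) (hΦr : ∀ x, Φ x ≠ 0 → ‖x‖ < 1 / 2)
    (hΨr : ∀ x, Ψ x ≠ 0 → ‖x‖ < 1 / 2) (hΨ : ∀ x, Ψ x ^ 2 = Φ (dualInv M x) ^ 2 - Φ x ^ 2)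
    (hφ : ∀ x, (φ x : ℂ) = 𝓕⁻ (fun w => (Φ w : ℂ)) x)
    (hψ : ∀ x, (ψ x : ℂ) = 𝓕⁻ (fun w => (Ψ w : ℂ)) x) (J : ℤ) :
    IsTightFrame (nonhomSystem M J (toComplex φ) (toComplex ψ)) := by
  have hΦc : HasCompactSupport Φ := hasCompactSupport_of_norm_le fun x hx => (hΦr x hx).le
  have hΨc : HasCompactSupport Ψ := hasCompactSupport_of_norm_le fun x hx => (hΨr x hx).le
  have hmφ : ∀ k : Fin d → ℤ, MemLp (dilate (M ^ J) (latticePt k) (toComplex φ)) 2 volume :=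
    fun k => memLp_dilate hΦs hΦc hφ (det_zpow_ne_zero hM J) _
  have hmψ : ∀ (j : ℤ) (k : Fin d → ℤ),
      MemLp (dilate (M ^ j) (latticePt k) (toComplex ψ)) 2 volume :=
    fun j k => memLp_dilate hΨs hΨc hψ (det_zpow_ne_zero hM j) _
  refine ⟨fun i => match i with
    | Sum.inl k => hmφ k
    | Sum.inr (j, k) => hmψ j k, fun f => ?_⟩
  have h1 := hasSum_sq_inner_dilate hΦs hΦr hφ (det_zpow_ne_zero hM J) hmφ f
  have h2 := fun j : ℤ => hasSum_sq_inner_dilate hΨs hΨr hψ (det_zpow_ne_zero hM j) (hmψ j) f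
  simp only [integral_highPass_eq_sub hM hΦs.continuous hΦ1 hΨ] at h2
  have h3 := hasSum_ge_telescope (energy_le_add_one hM hΦs.continuous hΦ1 hΨ (𝓕 f))
    (tendsto_energy_atTop hM hL hΦs.continuous hΦ1 hΦ0 f) J
  have h4 := hasSum_prod_of_nonneg
    (f := fun p : {j : ℤ // J ≤ j} × (Fin d → ℤ) => ‖inner ℂ ((hmψ p.1 p.2).toLp _) f‖ ^ 2)
    (fun p => by positivity) (fun j => h2 j) h3
  have h5 := hasSum_sum_type (f := fun i : (Fin d → ℤ) ⊕ ({j : ℤ // J ≤ j} × (Fin d → ℤ)) =>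
    match i with
    | Sum.inl k => ‖inner ℂ ((hmφ k).toLp _) f‖ ^ 2
    | Sum.inr p => ‖inner ℂ ((hmψ p.1 p.2).toLp _) f‖ ^ 2) h1 h4
  have h6 : ∫ w, Φ (matVec ((M ^ J)⁻¹).transpose w) ^ 2 *
      ‖(𝓕 f : Lp ℂ 2 (volume : Measure (Space d))) w‖ ^ 2 = energy M Φ (𝓕 f) J := rfl
  rw [h6, add_sub_cancel] at h5
  refine h5.congr_fun fun i => ?_
  rcases i with k | ⟨j, k⟩ <;> rfl

theorem isTightFrame_homSystem (hd : 0 < d) (hM : M.det ≠ 0)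
    (hL : Tendsto (fun n : ℕ => dualInv M ^ n) atTop (𝓝 0))
    (hΦ : Continuous Φ) (hΨs : ContDiff ℝ ∞ Ψ) (hΦ1 : ∀ x, Φ x ^ 2 ≤ 1)
    (hΦ0 : ∀ᶠ x in 𝓝 0, Φ x = 1) (hΦr : ∀ x, Φ x ≠ 0 → ‖x‖ < 1 / 2)
    (hΨr : ∀ x, Ψ x ≠ 0 → ‖x‖ < 1 / 2) (hΨ : ∀ x, Ψ x ^ 2 = Φ (dualInv M x) ^ 2 - Φ x ^ 2)
    (hψ : ∀ x, (ψ x : ℂ) = 𝓕⁻ (fun w => (Ψ w : ℂ)) x) :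
    IsTightFrame (homSystem M (toComplex ψ)) := by
  have hΨc : HasCompactSupport Ψ := hasCompactSupport_of_norm_le fun x hx => (hΨr x hx).le
  have hmψ : ∀ (j : ℤ) (k : Fin d → ℤ),
      MemLp (dilate (M ^ j) (latticePt k) (toComplex ψ)) 2 volume :=
    fun j k => memLp_dilate hΨs hΨc hψ (det_zpow_ne_zero hM j) _
  refine ⟨fun p => hmψ p.1 p.2, fun f => ?_⟩
  have h2 := fun j : ℤ => hasSum_sq_inner_dilate hΨs hΨr hψ (det_zpow_ne_zero hM j) (hmψ j) f
  simp only [integral_highPass_eq_sub hM hΦ hΦ1 hΨ] at h2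
  have h3 := hasSum_int_telescope (energy_le_add_one hM hΦ hΦ1 hΨ (𝓕 f))
    (tendsto_energy_atBot hd hM hL hΦ hΦ1 (fun x hx => (hΦr x hx).le) (𝓕 f))
    (tendsto_energy_atTop hM hL hΦ hΦ1 hΦ0 f)
  rw [sub_zero] at h3
  exact hasSum_prod_of_nonneg
    (f := fun p : ℤ × (Fin d → ℤ) => ‖inner ℂ ((hmψ p.1 p.2).toLp _) f‖ ^ 2)
    (fun p => by positivity) h2 h3

end Frames

/-! ### Refinable structure -/

theorem norm_le_half_of_scaled {ξ : Space d} (h : ‖(2 * Real.pi)⁻¹ • ξ‖ ≤ 1 / 16) :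
    ‖ξ‖ ≤ 1 / 2 := by
  rw [norm_smul, Real.norm_of_nonneg (by positivity), inv_mul_le_iff₀ (by positivity)] at h
  linarith [Real.pi_le_four]

/-- The regularity of a rescaled symbol, regarded as a function of angular frequency. -/
theorem scaled_symbol_properties {Ψ : Space d → ℝ} (hs : ContDiff ℝ ∞ Ψ)
    (he : ∀ x, Ψ (-x) = Ψ x) (hr : ∀ x, Ψ x ≠ 0 → ‖x‖ ≤ 1 / 16) :
    HasCompactSupport (fun ξ : Space d => (Ψ ((2 * Real.pi)⁻¹ • ξ) : ℂ)) ∧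
      ContDiff ℝ ∞ (fun ξ : Space d => (Ψ ((2 * Real.pi)⁻¹ • ξ) : ℂ)) ∧
      Function.Even (fun ξ : Space d => (Ψ ((2 * Real.pi)⁻¹ • ξ) : ℂ)) := by
  refine ⟨hasCompactSupport_of_norm_le (r := 1 / 2) fun ξ hξ => norm_le_half_of_scaled
    (hr _ (Complex.ofReal_ne_zero.mp hξ)), ?_, fun ξ => ?_⟩
  · exact Complex.ofRealCLM.contDiff.comp (hs.comp (contDiff_const_smul _))
  · simp only [smul_neg, he]

/-- If `H (Mᵀ ξ) = G ξ F ξ` with `F` supported inside a period cell, then the factor `G`, also after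
a modulation, may be replaced by a periodic one. -/
theorem exists_periodic_masks (M : Matrix (Fin d) (Fin d) ℝ) {F G H : Space d → ℂ}
    (hG : ContDiff ℝ ∞ G) (hF : ∀ ξ, F ξ ≠ 0 → ‖ξ‖ ≤ 1 / 2)
    (hH : ∀ ξ, H (matVec M.transpose ξ) = G ξ * F ξ) :
    ∃ a : (Fin d → ℤ) → Space d → ℂ, (∀ k, ContDiff ℝ ∞ (a k) ∧ IsTwoPiPeriodic (a k)) ∧
      ∀ (k : Fin d → ℤ) (ξ : Space d),
        Complex.exp (-(Complex.I * (inner ℝ (latticePt k) (matVec M.transpose ξ) : ℂ))) *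
          H (matVec M.transpose ξ) = a k ξ * F ξ := by
  have hsm : ∀ k : Fin d → ℤ, ContDiff ℝ ∞ fun ξ : Space d =>
      Complex.exp (-(Complex.I * (inner ℝ (latticePt k) (matVec M.transpose ξ) : ℂ))) * G ξ :=
    fun k => by
      have h1 : ContDiff ℝ ∞ fun ξ : Space d =>
          ((inner ℝ (latticePt k) (matVec M.transpose ξ) : ℝ) : ℂ) :=
        Complex.ofRealCLM.contDiff.comp (contDiff_const.inner ℝ (contDiff_matVec M.transpose))
      exact (contDiff_const.mul h1).neg.cexp.mul hG
  choose a ha haeq using fun k => exists_periodic_extension (hsm k)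
  refine ⟨a, ha, fun k ξ => ?_⟩
  by_cases h0 : F ξ = 0
  · rw [hH, h0, mul_zero, mul_zero, mul_zero]
  · rw [haeq k ξ (hF ξ h0), hH]
    ring

end WaveletFrame

open WaveletFrame Filter in
theorem mainTheorem1 (d : ℕ) (hd : 0 < d) (M : Matrix (Fin d) (Fin d) ℝ)
    (hM : WaveletFrame.IsExpansive M) :
    ∃ φ ψ : SchwartzMap (WaveletFrame.Space d) ℝ,
      -- (i) nonhomogeneous tight frames at all coarsest scales
      (∀ J : ℤ, WaveletFrame.IsTightFrame (WaveletFrame.nonhomSystem M J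
        (WaveletFrame.toComplex φ) (WaveletFrame.toComplex ψ))) ∧
      -- (ii) the Fourier transforms are compactly supported, smooth and even
      (HasCompactSupport (WaveletFrame.fourierHat (WaveletFrame.toComplex φ)) ∧
        ContDiff ℝ ∞ (WaveletFrame.fourierHat (WaveletFrame.toComplex φ)) ∧
        Function.Even (WaveletFrame.fourierHat (WaveletFrame.toComplex φ))) ∧
      (HasCompactSupport (WaveletFrame.fourierHat (WaveletFrame.toComplex ψ)) ∧
        ContDiff ℝ ∞ (WaveletFrame.fourierHat (WaveletFrame.toComplex ψ)) ∧
        Function.Even (WaveletFrame.fourierHat (WaveletFrame.toComplex ψ))) ∧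
      -- (iii) vanishing near the origin, and vanishing moments of all orders
      (∀ᶠ ξ in 𝓝 (0 : WaveletFrame.Space d),
        WaveletFrame.fourierHat (WaveletFrame.toComplex ψ) ξ = 0) ∧
      (∀ α : Fin d → ℕ, ∫ x : WaveletFrame.Space d, (∏ i, x i ^ α i) * ψ x = 0) ∧
      -- (iv) the refinable structure
      (∃ a b : (Fin d → ℤ) → WaveletFrame.Space d → ℂ,
        (∀ k, ContDiff ℝ ∞ (a k) ∧ WaveletFrame.IsTwoPiPeriodic (a k)) ∧
        (∀ k, ContDiff ℝ ∞ (b k) ∧ WaveletFrame.IsTwoPiPeriodic (b k)) ∧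
        ∀ (k : Fin d → ℤ) (ξ : WaveletFrame.Space d),
          Complex.exp (-(Complex.I *
              (inner ℝ (WaveletFrame.latticePt k) (WaveletFrame.matVec M.transpose ξ) : ℂ))) *
            WaveletFrame.fourierHat (WaveletFrame.toComplex φ)
              (WaveletFrame.matVec M.transpose ξ) =
            a k ξ * WaveletFrame.fourierHat (WaveletFrame.toComplex φ) ξ ∧
          Complex.exp (-(Complex.I *
              (inner ℝ (WaveletFrame.latticePt k) (WaveletFrame.matVec M.transpose ξ) : ℂ))) *
            WaveletFrame.fourierHat (WaveletFrame.toComplex ψ)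
              (WaveletFrame.matVec M.transpose ξ) =
            b k ξ * WaveletFrame.fourierHat (WaveletFrame.toComplex φ) ξ) ∧
      -- the homogeneous tight frame
      WaveletFrame.IsTightFrame (WaveletFrame.homSystem M (WaveletFrame.toComplex ψ)) := by
  have hdet := hM.det_ne_zero
  have hu : IsUnit M.det := isUnit_iff_ne_zero.mpr hdet
  have hL := hM.tendsto_dualInv_pow hd
  have hNL : ∀ x, Matrix.toEuclideanCLM (𝕜 := ℝ) M.transpose (dualInv M x) = x := fun x => by
    change matVec M.transpose (matVec (M⁻¹).transpose x) = x
    rw [← matVec_mul, ← Matrix.transpose_mul, Matrix.nonsing_inv_mul _ hu, Matrix.transpose_one,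
      matVec_one]
  have hLN : ∀ x, dualInv M (matVec M.transpose x) = x := matVec_transpose_inv_cancel hdet
  obtain ⟨Φ, C, hΦs, hCs, hΦe, hCe, hΦC, hΦ0, hΦr, hΦLr, hΦL⟩ :=
    exists_lowPass_symbol hNL hL (r := 1 / 16) (by norm_num)
  set Ψ : Space d → ℝ := fun x => Φ (dualInv M x) * C x with hΨdef
  have hΨs : ContDiff ℝ ∞ Ψ := (hΦs.comp (dualInv M).contDiff).mul hCs
  have hΨe : ∀ x, Ψ (-x) = Ψ x := fun x => by simp only [hΨdef, map_neg, hΦe, hCe]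
  have hΨr : ∀ x, Ψ x ≠ 0 → ‖x‖ ≤ 1 / 16 := fun x hx => hΦLr x (left_ne_zero_of_mul hx)
  have hΦ1 : ∀ x, Φ x ^ 2 ≤ 1 := fun x => by nlinarith [hΦC x, sq_nonneg (C x)]
  -- Where `Φ x ≠ 0`, the factor `Φ (L x)` equals `1`, so `Φ (L x)² (1 - Φ x²)` is a difference.
  have hΨ : ∀ x, Ψ x ^ 2 = Φ (dualInv M x) ^ 2 - Φ x ^ 2 := fun x => by
    have hC : C x ^ 2 = 1 - Φ x ^ 2 := by linarith [hΦC x]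
    rw [hΨdef, mul_pow, hC]
    by_cases h0 : Φ x = 0
    · simp [h0]
    · simp [hΦL x h0]
  have hΨ0 : ∀ᶠ x in 𝓝 0, Ψ x = 0 := by
    filter_upwards [hΦ0] with x hx
    have hC := hΦC x
    rw [hx] at hC
    have hC0 : C x = 0 := pow_eq_zero_iff two_ne_zero |>.mp (by linarith)
    simp [hΨdef, hC0]
  have hΦc : HasCompactSupport Φ := hasCompactSupport_of_norm_le hΦr
  have hΨc : HasCompactSupport Ψ := hasCompactSupport_of_norm_le hΨr
  obtain ⟨φ, hφ⟩ := exists_schwartz_of_symbol hΦs hΦe hΦc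
  obtain ⟨ψ, hψ⟩ := exists_schwartz_of_symbol hΨs hΨe hΨc
  have hφhat : fourierHat (toComplex φ) = fun ξ => (Φ ((2 * Real.pi)⁻¹ • ξ) : ℂ) :=
    funext fun ξ => by
      rw [fourierHat_eq_fourier, fourier_toComplex_eq hΦs hΦc hφ]
  have hψhat : fourierHat (toComplex ψ) = fun ξ => (Ψ ((2 * Real.pi)⁻¹ • ξ) : ℂ) :=
    funext fun ξ => by
      rw [fourierHat_eq_fourier, fourier_toComplex_eq hΨs hΨc hψ]
  -- The radius `1 / 16` serves two purposes: it is below `1 / 2`, so `ℤᵈ`-translates do not overlap,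
  -- and `2π / 16 ≤ 1 / 2`, the radius on which the periodic masks are prescribed.
  have hlt : ∀ {F : Space d → ℝ}, (∀ x, F x ≠ 0 → ‖x‖ ≤ 1 / 16) → ∀ x, F x ≠ 0 → ‖x‖ < 1 / 2 :=
    fun h x hx => (h x hx).trans_lt (by norm_num)
  have hscale : ∀ ξ : Space d, (2 * Real.pi)⁻¹ • matVec M.transpose ξ =
      matVec M.transpose ((2 * Real.pi)⁻¹ • ξ) := fun ξ =>
    (map_smul (Matrix.toEuclideanCLM (𝕜 := ℝ) M.transpose) _ ξ).symm
  have hmask : ∀ {G : Space d → ℝ}, ContDiff ℝ ∞ G → ContDiff ℝ ∞ fun ξ : Space d =>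
      (G (matVec M.transpose ((2 * Real.pi)⁻¹ • ξ)) : ℂ) := fun hG =>
    Complex.ofRealCLM.contDiff.comp
      (hG.comp ((contDiff_matVec M.transpose).comp (contDiff_const_smul _)))
  have hsuppΦ : ∀ ξ : Space d, (Φ ((2 * Real.pi)⁻¹ • ξ) : ℂ) ≠ 0 → ‖ξ‖ ≤ 1 / 2 := fun ξ hξ =>
    norm_le_half_of_scaled (hΦr _ (Complex.ofReal_ne_zero.mp hξ))
  obtain ⟨a, ha, haeq⟩ := exists_periodic_masks M (hmask hΦs) hsuppΦ
    (H := fun ξ => (Φ ((2 * Real.pi)⁻¹ • ξ) : ℂ)) (fun ξ => by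
      simp only [hscale]
      by_cases h0 : Φ (matVec M.transpose ((2 * Real.pi)⁻¹ • ξ)) = 0
      · simp only [h0, Complex.ofReal_zero, zero_mul]
      · have h1 := hΦL _ h0
        rw [hLN] at h1
        rw [h1, Complex.ofReal_one, mul_one])
  obtain ⟨b, hb, hbeq⟩ := exists_periodic_masks M (hmask hCs) hsuppΦ
    (H := fun ξ => (Ψ ((2 * Real.pi)⁻¹ • ξ) : ℂ)) (fun ξ => by
      simp only [hscale, hΨdef, hLN]
      push_cast
      ring)
  refine ⟨φ, ψ, fun J => isTightFrame_nonhomSystem hdet hL hΦs hΨs hΦ1 hΦ0 (hlt hΦr) (hlt hΨr) hΨ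
    hφ hψ J, ?_, ?_, ?_, fun α => integral_monomial_mul_eq_zero ?_ α, ⟨a, b, ha, hb, ?_⟩,
    isTightFrame_homSystem hd hdet hL hΦs.continuous hΨs hΦ1 hΦ0 (hlt hΦr) (hlt hΨr) hΨ hψ⟩
  · rw [hφhat]
    exact scaled_symbol_properties hΦs hΦe hΦr
  · rw [hψhat]
    exact scaled_symbol_properties hΨs hΨe hΨr
  · have h1 : Tendsto (fun ξ : Space d => (2 * Real.pi)⁻¹ • ξ) (𝓝 0) (𝓝 0) := by
      simpa using (continuous_const_smul (2 * Real.pi)⁻¹).tendsto (0 : Space d)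
    filter_upwards [h1.eventually hΨ0] with ξ hξ
    rw [hψhat]
    simp only [hξ, Complex.ofReal_zero]
  · filter_upwards [hΨ0] with w hw
    rw [fourier_toComplex_eq hΨs hΨc hψ, hw, Complex.ofReal_zero]
  · intro k ξ
    rw [hφhat, hψhat]
    exact ⟨haeq k ξ, hbeq k ξ⟩
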